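/- A net $(f_j)_{j\in J}$ (indexed by a non-empty directed set $J$) of functions that are analytic on a neighbourhood of the closed unit disk in $\mathbb{C}$ is called a \emph{weighting scheme} if $f_j(1)=1$ for all $j$, $f_j^{(k)}(0)\ge 0$ for all $j\in J$ and all integers $k\ge 0$, and $|f_j(z)|\to 0$ along $j$ for every $z\in\mathbb{C}$ with $|z|<1$. A bounded linear operator $T$ on a complex Banach space with spectral radius $r(T)=1$ is called \emph{(WS)-bounded} if there is a weighting scheme $(f_j)_{j\in J}$ such that the operators $f_j(T)$, $j\in J$, given by the analytic functional calculus, are bounded in operator norm. \textbf{Proposition.} Let $E$ be a complex Banach lattice and let $T\in\mathcal{L}(E)$ with $r(T)=1$ be positive and (WS)-bounded. Then there exists a closed (lattice) ideal $I\subset E$ with the following properties: (a) $I$ is $T$-invariant, i.e. $T(I)\subset I$. (b) For each eigenvector $z\in E$ of $T$ which belongs to a peripheral eigenvalue (an eigenvalue $\lambda$ with $|\lambda|=r(T)=1$) we have $z\notin I$, but $T|z|-|z|\in I$. (c) Whenever $x\in E$ and $\|T^k|x|\|\to 0$ as $k\to\infty$, then $x\in I$. -/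

import Mathlib

open Set Filter Topology
open scoped NNReal ENNReal

universe u w

/-! ### Complex Banach lattices

A real Banach lattice is a type `F` with
`[NormedAddCommGroup F] [NormedSpace ℝ F] [Lattice F] [IsOrderedAddMonoid F]`
`[IsOrderedModule ℝ F] [HasSolidNorm F] [CompleteSpace F]`.
A complex Banach lattice is the complexification `F ⊕ iF` of a real Banach lattice `F`, with the
modulus `|x + iy| = sup_θ (cos θ • x + sin θ • y)` and the norm `‖z‖ = ‖|z|‖`. -/

/-- The complexification `F ⊕ iF`; the pair `⟨x, y⟩` stands for `x + iy`. -/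
@[ext]
structure Complexification (F : Type*) where
  re : F
  im : F

namespace Complexification

section Algebra

variable {F : Type*} [AddCommGroup F]

instance : Zero (Complexification F) := ⟨⟨0, 0⟩⟩
instance : Add (Complexification F) := ⟨fun z w => ⟨z.re + w.re, z.im + w.im⟩⟩
instance : Neg (Complexification F) := ⟨fun z => ⟨-z.re, -z.im⟩⟩
instance : Sub (Complexification F) := ⟨fun z w => ⟨z.re - w.re, z.im - w.im⟩⟩

@[simp] theorem zero_re : (0 : Complexification F).re = 0 := rfl
@[simp] theorem zero_im : (0 : Complexification F).im = 0 := rfl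
@[simp] theorem add_re (z w : Complexification F) : (z + w).re = z.re + w.re := rfl
@[simp] theorem add_im (z w : Complexification F) : (z + w).im = z.im + w.im := rfl
@[simp] theorem neg_re (z : Complexification F) : (-z).re = -z.re := rfl
@[simp] theorem neg_im (z : Complexification F) : (-z).im = -z.im := rfl
@[simp] theorem sub_re (z w : Complexification F) : (z - w).re = z.re - w.re := rfl
@[simp] theorem sub_im (z w : Complexification F) : (z - w).im = z.im - w.im := rfl

instance : AddCommGroup (Complexification F) where
  add_assoc _ _ _ := Complexification.ext (add_assoc _ _ _) (add_assoc _ _ _)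
  zero_add _ := Complexification.ext (zero_add _) (zero_add _)
  add_zero _ := Complexification.ext (add_zero _) (add_zero _)
  add_comm _ _ := Complexification.ext (add_comm _ _) (add_comm _ _)
  neg_add_cancel _ := Complexification.ext (neg_add_cancel _) (neg_add_cancel _)
  sub_eq_add_neg _ _ := Complexification.ext (sub_eq_add_neg _ _) (sub_eq_add_neg _ _)
  nsmul := nsmulRec
  zsmul := zsmulRec

variable [Module ℝ F]

/-- `(a + ib)(x + iy) = (ax - by) + i(ay + bx)`. -/
instance : SMul ℂ (Complexification F) :=
  ⟨fun c z => ⟨c.re • z.re - c.im • z.im, c.re • z.im + c.im • z.re⟩⟩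

@[simp] theorem smul_re (c : ℂ) (z : Complexification F) :
    (c • z).re = c.re • z.re - c.im • z.im := rfl
@[simp] theorem smul_im (c : ℂ) (z : Complexification F) :
    (c • z).im = c.re • z.im + c.im • z.re := rfl

instance : Module ℂ (Complexification F) where
  one_smul z := by ext <;> simp
  mul_smul a b z := by ext <;> simp <;> module
  smul_zero a := by ext <;> simp
  smul_add a z w := by ext <;> simp <;> module
  add_smul a b z := by ext <;> simp <;> module
  zero_smul z := by ext <;> simp

/-- The real part of `e^{-iθ} z`, that is `cos θ • x + sin θ • y` for `z = x + iy`. -/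
noncomputable def rotRe (z : Complexification F) (θ : ℝ) : F :=
  Real.cos θ • z.re + Real.sin θ • z.im

end Algebra

/-- The inclusion of the real part `F` into `F ⊕ iF`. -/
def ofReal {F : Type*} [Zero F] (x : F) : Complexification F := ⟨x, 0⟩

theorem smul_le_abs_smul {F : Type*} [AddCommGroup F] [Module ℝ F] [Lattice F]
    [IsOrderedAddMonoid F] [IsOrderedModule ℝ F] (t : ℝ) (x : F) : t • x ≤ |t| • |x| := by
  rcases le_total 0 t with ht | ht
  · rw [abs_of_nonneg ht]
    exact smul_le_smul_of_nonneg_left (le_abs_self x) ht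
  · rw [abs_of_nonpos ht, ← neg_smul_neg]
    exact smul_le_smul_of_nonneg_left (neg_le_abs x) (neg_nonneg.2 ht)

section BanachLattice

variable {F : Type*} [NormedAddCommGroup F] [NormedSpace ℝ F] [Lattice F]
  [IsOrderedAddMonoid F] [IsOrderedModule ℝ F] [HasSolidNorm F]

theorem rotRe_le_add (z : Complexification F) (θ ψ : ℝ) :
    z.rotRe θ ≤ z.rotRe ψ + |θ - ψ| • (|z.re| + |z.im|) := by
  have key : z.rotRe θ - z.rotRe ψ =
      (Real.cos θ - Real.cos ψ) • z.re + (Real.sin θ - Real.sin ψ) • z.im := by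
    unfold rotRe; module
  have hc : |Real.cos θ - Real.cos ψ| ≤ |θ - ψ| := by
    simpa [Real.dist_eq] using Real.lipschitzWith_cos.dist_le_mul θ ψ
  have hs : |Real.sin θ - Real.sin ψ| ≤ |θ - ψ| := by
    simpa [Real.dist_eq] using Real.lipschitzWith_sin.dist_le_mul θ ψ
  rw [← sub_le_iff_le_add', key, smul_add]
  exact add_le_add
    ((smul_le_abs_smul _ _).trans (smul_le_smul_of_nonneg_right hc (abs_nonneg _)))
    ((smul_le_abs_smul _ _).trans (smul_le_smul_of_nonneg_right hs (abs_nonneg _)))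

/-- In a real Banach lattice the supremum that defines the modulus exists. -/
theorem exists_isLUB_rotRe [CompleteSpace F] (z : Complexification F) :
    ∃ m : F, IsLUB (range z.rotRe) m := by
  set e : F := |z.re| + |z.im| with he
  have he0 : 0 ≤ e := add_nonneg (abs_nonneg _) (abs_nonneg _)
  let c : ℕ → ℝ := fun n => 2 * Real.pi / ((n : ℝ) + 1)
  have hc0 : ∀ n, 0 ≤ c n := fun n => by positivity
  have hc : Tendsto c atTop (𝓝 0) := by
    have h := (tendsto_one_div_add_atTop_nhds_zero_nat (𝕜 := ℝ)).const_mul (2 * Real.pi)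
    simpa [c, div_eq_mul_inv] using h
  let s : ℕ → F := fun n =>
    (Finset.range (n + 1)).sup' Finset.nonempty_range_add_one fun k => z.rotRe (k * c n)
  have hup : ∀ n θ, z.rotRe θ ≤ s n + c n • e := by
    intro n θ
    obtain ⟨ψ, ⟨hψ0, hψ1⟩, hψ⟩ : ∃ ψ ∈ Ico (0 : ℝ) (2 * Real.pi), z.rotRe θ = z.rotRe ψ := by
      have hper : Function.Periodic z.rotRe (2 * Real.pi) := fun t => by
        simp [rotRe, Real.cos_add_two_pi, Real.sin_add_two_pi]
      exact hper.exists_mem_Ico₀ Real.two_pi_pos θ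
    have hcn : 0 < c n := by positivity
    have hk : ⌊ψ / c n⌋₊ ∈ Finset.range (n + 1) := by
      rw [Finset.mem_range, Nat.floor_lt (by positivity), div_lt_iff₀ hcn]
      have : ((n + 1 : ℕ) : ℝ) * c n = 2 * Real.pi := by
        simp only [c]; push_cast; field_simp
      rwa [this]
    have h1 : (⌊ψ / c n⌋₊ : ℝ) * c n ≤ ψ := by
      rw [← le_div_iff₀ hcn]; exact Nat.floor_le (by positivity)
    have h2 : ψ < ((⌊ψ / c n⌋₊ : ℝ) + 1) * c n := by
      rw [← div_lt_iff₀ hcn]; exact Nat.lt_floor_add_one _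
    rw [hψ]
    refine (rotRe_le_add z ψ (⌊ψ / c n⌋₊ * c n)).trans (add_le_add ?_ ?_)
    · exact Finset.le_sup' (fun k : ℕ => z.rotRe (k * c n)) hk
    · refine smul_le_smul_of_nonneg_right ?_ he0
      rw [abs_of_nonneg (sub_nonneg.2 h1)]
      linarith
  have hss : ∀ m n, s m ≤ s n + c n • e := fun m n =>
    Finset.sup'_le _ _ fun k _ => hup n _
  have hcauchy : CauchySeq s := by
    refine cauchySeq_of_le_tendsto_0 (fun n => 2 * (c n * ‖e‖)) ?_ ?_
    · intro n m N hn hm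
      have hmono : ∀ i, N ≤ i → c i ≤ c N := fun i hi => by
        have : (N : ℝ) ≤ i := by exact_mod_cast hi
        exact div_le_div_of_nonneg_left (by positivity) (by positivity) (by linarith)
      have h1 : |s n - s m| ≤ |c N • e| := by
        rw [abs_of_nonneg (smul_nonneg (hc0 N) he0)]
        refine abs_le'.2 ⟨?_, ?_⟩
        · rw [sub_le_iff_le_add']
          exact (hss n m).trans (by gcongr; exact hmono m hm)
        · rw [neg_sub, sub_le_iff_le_add']
          exact (hss m n).trans (by gcongr; exact hmono n hn)
      have h2 := HasSolidNorm.solid h1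
      rw [norm_smul, Real.norm_of_nonneg (hc0 N)] at h2
      rw [dist_eq_norm]
      have := mul_nonneg (hc0 N) (norm_nonneg e)
      linarith
    · simpa using (hc.mul_const ‖e‖).const_mul 2
  obtain ⟨m, hm⟩ := cauchySeq_tendsto_of_complete hcauchy
  refine ⟨m, ?_, ?_⟩
  · rintro _ ⟨θ, rfl⟩
    have hlim : Tendsto (fun n => s n + c n • e) atTop (𝓝 (m + (0 : ℝ) • e)) :=
      hm.add (hc.smul_const e)
    rw [zero_smul, add_zero] at hlim
    exact ge_of_tendsto' hlim fun n => hup n θ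
  · intro b hb
    exact le_of_tendsto' hm fun n => Finset.sup'_le _ _ fun k _ => hb ⟨_, rfl⟩

variable [CompleteSpace F]

/-- The modulus `|x + iy| = sup_θ (cos θ • x + sin θ • y)`, an element of the real part `F`. -/
noncomputable def modulus (z : Complexification F) : F := (exists_isLUB_rotRe z).choose

theorem isLUB_modulus (z : Complexification F) : IsLUB (range z.rotRe) z.modulus :=
  (exists_isLUB_rotRe z).choose_spec

theorem rotRe_le_modulus (z : Complexification F) (θ : ℝ) : z.rotRe θ ≤ z.modulus :=
  (isLUB_modulus z).1 ⟨θ, rfl⟩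

theorem abs_rotRe_le_modulus (z : Complexification F) (θ : ℝ) : |z.rotRe θ| ≤ z.modulus := by
  refine abs_le'.2 ⟨rotRe_le_modulus z θ, ?_⟩
  have h := rotRe_le_modulus z (θ + Real.pi)
  simpa [rotRe, Real.cos_add_pi, Real.sin_add_pi, add_comm] using h

theorem modulus_nonneg (z : Complexification F) : 0 ≤ z.modulus :=
  (abs_nonneg _).trans (abs_rotRe_le_modulus z 0)

theorem abs_re_le_modulus (z : Complexification F) : |z.re| ≤ z.modulus := by
  simpa [rotRe] using abs_rotRe_le_modulus z 0

theorem abs_im_le_modulus (z : Complexification F) : |z.im| ≤ z.modulus := by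
  simpa [rotRe] using abs_rotRe_le_modulus z (Real.pi / 2)

theorem modulus_add_le (z w : Complexification F) :
    (z + w).modulus ≤ z.modulus + w.modulus := by
  refine (isLUB_modulus (z + w)).2 ?_
  rintro _ ⟨θ, rfl⟩
  have : (z + w).rotRe θ = z.rotRe θ + w.rotRe θ := by simp only [rotRe, add_re, add_im]; module
  rw [this]
  exact add_le_add (rotRe_le_modulus z θ) (rotRe_le_modulus w θ)

theorem modulus_le_add (z : Complexification F) : z.modulus ≤ |z.re| + |z.im| := by
  refine (isLUB_modulus z).2 ?_
  rintro _ ⟨θ, rfl⟩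
  refine add_le_add ((smul_le_abs_smul _ _).trans ?_) ((smul_le_abs_smul _ _).trans ?_)
  · simpa using smul_le_smul_of_nonneg_right (Real.abs_cos_le_one θ) (abs_nonneg z.re)
  · simpa using smul_le_smul_of_nonneg_right (Real.abs_sin_le_one θ) (abs_nonneg z.im)

theorem modulus_smul_le (c : ℂ) (z : Complexification F) :
    (c • z).modulus ≤ ‖c‖ • z.modulus := by
  refine (isLUB_modulus (c • z)).2 ?_
  rintro _ ⟨θ, rfl⟩
  have h : (c • z).rotRe θ = ‖c‖ • z.rotRe (θ - c.arg) := by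
    simp only [rotRe, smul_re, smul_im, Real.cos_sub, Real.sin_sub]
    rw [← Complex.norm_mul_cos_arg c, ← Complex.norm_mul_sin_arg c]
    module
  rw [h]
  exact smul_le_smul_of_nonneg_left (rotRe_le_modulus z _) (norm_nonneg c)

theorem modulus_zero : (0 : Complexification F).modulus = 0 :=
  le_antisymm (by simpa using modulus_le_add (0 : Complexification F)) (modulus_nonneg _)

theorem modulus_smul (c : ℂ) (z : Complexification F) :
    (c • z).modulus = ‖c‖ • z.modulus := by
  refine le_antisymm (modulus_smul_le c z) ?_
  rcases eq_or_ne c 0 with rfl | hc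
  · simp [modulus_zero]
  · have h := smul_le_smul_of_nonneg_left (modulus_smul_le c⁻¹ (c • z)) (norm_nonneg c)
    rwa [inv_smul_smul₀ hc, smul_smul, norm_inv, mul_inv_cancel₀ (norm_ne_zero_iff.2 hc),
      one_smul] at h

noncomputable instance : Norm (Complexification F) := ⟨fun z => ‖z.modulus‖⟩

theorem norm_def (z : Complexification F) : ‖z‖ = ‖z.modulus‖ := rfl

theorem norm_re_le (z : Complexification F) : ‖z.re‖ ≤ ‖z‖ :=
  HasSolidNorm.solid ((abs_re_le_modulus z).trans (le_abs_self _))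

theorem norm_im_le (z : Complexification F) : ‖z.im‖ ≤ ‖z‖ :=
  HasSolidNorm.solid ((abs_im_le_modulus z).trans (le_abs_self _))

theorem norm_le_add (z : Complexification F) : ‖z‖ ≤ ‖z.re‖ + ‖z.im‖ := by
  have h : ‖z.modulus‖ ≤ ‖|z.re| + |z.im|‖ := HasSolidNorm.solid <| by
    rw [abs_of_nonneg (modulus_nonneg z)]
    exact (modulus_le_add z).trans (le_abs_self _)
  refine h.trans ((norm_add_le _ _).trans ?_)
  rw [norm_abs_eq_norm, norm_abs_eq_norm]

theorem normCore : NormedSpace.Core ℂ (Complexification F) where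
  norm_nonneg z := norm_nonneg z.modulus
  norm_smul c z := by rw [norm_def, modulus_smul, norm_smul, norm_norm, norm_def]
  norm_triangle z w := by
    have h : ‖(z + w).modulus‖ ≤ ‖z.modulus + w.modulus‖ := HasSolidNorm.solid <| by
      rw [abs_of_nonneg (modulus_nonneg _)]
      exact (modulus_add_le z w).trans (le_abs_self _)
    exact h.trans (norm_add_le _ _)
  norm_eq_zero_iff z := by
    constructor
    · intro h
      have h1 := norm_re_le z
      have h2 := norm_im_le z
      rw [h] at h1 h2
      exact Complexification.ext (norm_le_zero_iff.1 h1) (norm_le_zero_iff.1 h2)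
    · rintro rfl
      rw [norm_def, modulus_zero, norm_zero]

noncomputable instance : NormedAddCommGroup (Complexification F) :=
  NormedAddCommGroup.ofCore normCore

noncomputable instance : NormedSpace ℂ (Complexification F) :=
  NormedSpace.ofCore normCore

instance : CompleteSpace (Complexification F) := by
  refine Metric.complete_of_cauchySeq_tendsto fun u hu => ?_
  rw [Metric.cauchySeq_iff'] at hu
  have hre : CauchySeq fun n => (u n).re := Metric.cauchySeq_iff'.2 fun ε hε => by
    obtain ⟨N, hN⟩ := hu ε hε
    refine ⟨N, fun n hn => lt_of_le_of_lt ?_ (hN n hn)⟩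
    rw [dist_eq_norm, dist_eq_norm]
    exact norm_re_le (u n - u N)
  have him : CauchySeq fun n => (u n).im := Metric.cauchySeq_iff'.2 fun ε hε => by
    obtain ⟨N, hN⟩ := hu ε hε
    refine ⟨N, fun n hn => lt_of_le_of_lt ?_ (hN n hn)⟩
    rw [dist_eq_norm, dist_eq_norm]
    exact norm_im_le (u n - u N)
  obtain ⟨x, hx⟩ := cauchySeq_tendsto_of_complete hre
  obtain ⟨y, hy⟩ := cauchySeq_tendsto_of_complete him
  refine ⟨⟨x, y⟩, tendsto_iff_norm_sub_tendsto_zero.2 ?_⟩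
  refine squeeze_zero (fun n => norm_nonneg _) (fun n => norm_le_add _) ?_
  simpa using (tendsto_iff_norm_sub_tendsto_zero.1 hx).add
    (tendsto_iff_norm_sub_tendsto_zero.1 hy)

/-- `T ≥ 0`: the operator maps the positive cone, which lies in the real part, into itself. -/
def IsPositiveOp (T : Complexification F →L[ℂ] Complexification F) : Prop :=
  ∀ z : Complexification F, z.im = 0 → 0 ≤ z.re → (T z).im = 0 ∧ 0 ≤ (T z).re

/-- A lattice ideal: a complex subspace that is solid. -/
def IsLatticeIdeal (I : Submodule ℂ (Complexification F)) : Prop :=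
  ∀ z w : Complexification F, w ∈ I → z.modulus ≤ w.modulus → z ∈ I

end BanachLattice

end Complexification

/-! ### Weighting schemes and (WS)-bounded operators -/

/-- A weighting scheme: a net of functions that are analytic on a neighbourhood of the closed unit
disk, with `f_j(1) = 1`, nonnegative (in particular real) derivatives at `0`, and `f_j → 0`
pointwise on the open unit disk. Only the values of `f j` near the closed unit disk matter. -/
structure IsWeightingScheme {J : Type*} [Preorder J] (f : J → ℂ → ℂ) : Prop where
  analytic : ∀ j, AnalyticOnNhd ℂ (f j) (Metric.closedBall 0 1)
  eval_one : ∀ j, f j 1 = 1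
  deriv_nonneg : ∀ j k, 0 ≤ (iteratedDeriv k (f j) 0).re ∧ (iteratedDeriv k (f j) 0).im = 0
  tendsto_zero : ∀ z : ℂ, ‖z‖ < 1 → Tendsto (fun j => ‖f j z‖) atTop (𝓝 0)

section Operators

variable {X : Type*} [NormedAddCommGroup X] [NormedSpace ℂ X]

/-- A function analytic near the closed unit disk is analytic on a larger closed disk. -/
theorem exists_one_lt_analyticOnNhd {f : ℂ → ℂ} (hf : AnalyticOnNhd ℂ f (Metric.closedBall 0 1)) :
    ∃ R : ℝ, 1 < R ∧ AnalyticOnNhd ℂ f (Metric.closedBall 0 R) := by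
  obtain ⟨δ, hδ, h⟩ := (isCompact_closedBall (0 : ℂ) 1).exists_cthickening_subset_open
    (isOpen_analyticAt ℂ f) hf
  rw [cthickening_closedBall hδ.le zero_le_one] at h
  exact ⟨δ + 1, by linarith, h⟩

/-- The contour integral that defines `f(T)` does not depend on the radius of the contour. -/
theorem circleIntegral_smul_resolvent_eq [CompleteSpace X] {f : ℂ → ℂ} {T : X →L[ℂ] X}
    (hT : spectralRadius ℂ T ≤ 1) {r R : ℝ} (hr : 1 < r) (hrR : r ≤ R)
    (hf : AnalyticOnNhd ℂ f (Metric.closedBall 0 R)) :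
    (∮ z in C(0, R), f z • resolvent T z) = ∮ z in C(0, r), f z • resolvent T z := by
  have hd : ∀ z ∈ Metric.closedBall (0 : ℂ) R \ Metric.ball 0 r,
      DifferentiableAt ℂ (fun z => f z • resolvent T z) z := by
    rintro z ⟨hzR, hzr⟩
    refine (hf z hzR).differentiableAt.smul (spectrum.hasDerivAt_resolvent_const_left ?_).differentiableAt
    refine spectrum.mem_resolventSet_of_spectralRadius_lt (hT.trans_lt ?_)
    have hz : r ≤ ‖z‖ := by simpa using hzr
    have : 1 < ‖z‖₊ := by exact_mod_cast hr.trans_le hz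
    exact_mod_cast this
  refine Complex.circleIntegral_eq_of_differentiable_on_annulus_off_countable
    (by linarith) hrR countable_empty (fun z hz => (hd z hz).continuousAt.continuousWithinAt) ?_
  rintro z ⟨⟨hzR, hzr⟩, -⟩
  exact hd z ⟨Metric.ball_subset_closedBall hzR, fun h => hzr (Metric.ball_subset_closedBall h)⟩

open Classical in
/-- The analytic functional calculus `f(T) = (2πi)⁻¹ ∮_{|z| = R} f(z) (z - T)⁻¹ dz` for a function
`f` that is analytic on a neighbourhood of the closed unit disk and an operator `T` with spectral
radius at most `1`. Here `R > 1` is any radius such that `f` is analytic on the closed disk of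
radius `R`; by `circleIntegral_smul_resolvent_eq` its choice does not matter. -/
noncomputable def analyticCalculus (f : ℂ → ℂ) (T : X →L[ℂ] X) : X →L[ℂ] X :=
  if h : ∃ R : ℝ, 1 < R ∧ AnalyticOnNhd ℂ f (Metric.closedBall 0 R) then
    (2 * (Real.pi : ℂ) * Complex.I)⁻¹ • ∮ z in C(0, h.choose), f z • resolvent T z
  else 0

/-- An operator (of spectral radius `1`) is (WS)-bounded if `{f_j(T) | j ∈ J}` is norm bounded for
some weighting scheme `(f_j)`, indexed by a nonempty directed set `J`. -/
def IsWSBounded.{j, x} {X : Type x} [NormedAddCommGroup X] [NormedSpace ℂ X]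
    (T : X →L[ℂ] X) : Prop :=
  ∃ (J : Type j) (_ : Preorder J) (_ : IsDirectedOrder J) (_ : Nonempty J) (f : J → ℂ → ℂ),
    IsWeightingScheme f ∧ ∃ C : ℝ, ∀ j, ‖analyticCalculus (f j) T‖ ≤ C

/-- The spectral values of maximal modulus. -/
def peripheralSpectrum (T : X →L[ℂ] X) : Set ℂ :=
  {μ ∈ spectrum ℂ T | (‖μ‖₊ : ℝ≥0∞) = spectralRadius ℂ T}

end Operators

/-! A positive `T` is the complexification of a positive real operator `S` (`realOp`). Expanding
`f_j(T)` into its Taylor series turns the scheme into weights `a_j` on `ℕ`: they are nonnegative,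
have total mass `f_j(1) = 1`, and tend to `0` at every fixed `k`. The averages `∑ a_j(k) S^k` are
bounded by the constant `C` that bounds the `f_j(T)`.

Decay at each `k` is not enough; decay uniform in `k` is needed. Convex combinations supply it
(`IsBoundedWeight.exists_le`), as in Mazur's theorem for a weakly null net in `c₀`, and they keep
the bound `C`. The net is thereby replaced by a sequence of weights `b_m` with `sup_k b_m(k) ≤ ε_m →
0`. Let `A_m = ∑ b_m(k) S^k`, and let `I` consist of the `z` with `A_m |z| → 0`. It is solid because
`A_m ≥ 0`, closed because `‖A_m x‖ ≤ C ‖x‖`, and invariant because `A_m` commutes with `S` and `|Tz|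
≤ S|z|`.

For a peripheral eigenvector `z`, the modulus `u = |z|` satisfies `u ≤ Su`, so `S^k u` increases
with `k`. Hence `u ≤ A_m u`, which keeps `z` out of `I`. For large `m` at least half of the mass of
`b_m` lies beyond a given `n`, so `S^n u ≤ 2 A_m u`: the orbit of `u` is bounded, although `T` need
not be power bounded. Since the increments `S^k(Su - u)` are positive, `A_m(Su - u)` is dominated by
`ε_m` times a telescoping sum with bounded partial sums, and so tends to `0`. Property (c) is the
regularity of averages with uniformly small weights. -/

/-! ### Power series representation of the analytic functional calculus -/

section Calculus

/-- The `k`-th Taylor coefficient of `f` at `0`. -/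
noncomputable def taylorCoeff (f : ℂ → ℂ) (k : ℕ) : ℂ :=
  ((k.factorial : ℂ))⁻¹ * iteratedDeriv k f 0

theorem hasSum_taylorCoeff {f : ℂ → ℂ} {R : ℝ}
    (hf : AnalyticOnNhd ℂ f (Metric.closedBall 0 R)) {z : ℂ} (hz : ‖z‖ < R) :
    HasSum (fun k => taylorCoeff f k * z ^ k) (f z) := by
  have h := Complex.hasSum_taylorSeries_on_ball (c := 0) (r := R)
    (hf.differentiableOn.mono Metric.ball_subset_closedBall) (z := z) (by simpa using hz)
  refine h.congr_fun fun k => ?_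
  simp only [taylorCoeff, sub_zero, smul_eq_mul]
  ring

theorem ofReal_re_taylorCoeff {f : ℂ → ℂ}
    (hd : ∀ k, 0 ≤ (iteratedDeriv k f 0).re ∧ (iteratedDeriv k f 0).im = 0) (k : ℕ) :
    ((taylorCoeff f k).re : ℂ) = taylorCoeff f k := by
  refine Complex.ext rfl ?_
  rw [taylorCoeff, ← Complex.ofReal_natCast, ← Complex.ofReal_inv, Complex.im_ofReal_mul,
    (hd k).2, mul_zero, Complex.ofReal_im]

theorem re_taylorCoeff_nonneg {f : ℂ → ℂ}
    (hd : ∀ k, 0 ≤ (iteratedDeriv k f 0).re ∧ (iteratedDeriv k f 0).im = 0) (k : ℕ) :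
    0 ≤ (taylorCoeff f k).re := by
  rw [taylorCoeff, ← Complex.ofReal_natCast, ← Complex.ofReal_inv, Complex.re_ofReal_mul]
  exact mul_nonneg (by positivity) (hd k).1

/-- By Gelfand's formula `‖a ^ k‖ ≤ ρ ^ k` eventually, for any `ρ > 1`. Taking `ρ` with `ρ q < 1`
leaves a geometric series. -/
theorem summable_norm_pow_mul_pow {A : Type*} [NormedRing A] [NormedAlgebra ℂ A] [CompleteSpace A]
    {a : A} (ha : spectralRadius ℂ a ≤ 1) {q : ℝ} (hq0 : 0 ≤ q) (hq : q < 1) :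
    Summable fun k : ℕ => ‖a ^ k‖ * q ^ k := by
  obtain ⟨ρ, hρ1, hρq⟩ : ∃ ρ : ℝ, 1 < ρ ∧ ρ * q < 1 := by
    rcases hq0.eq_or_lt with rfl | hq0
    · exact ⟨2, by norm_num, by norm_num⟩
    · obtain ⟨ρ, h1, h2⟩ := exists_between ((one_lt_inv₀ hq0).2 hq)
      exact ⟨ρ, h1, by rwa [lt_inv_comm₀ (by linarith) hq0, ← one_div,
        lt_div_iff₀ (by linarith), mul_comm] at h2⟩
  have hρ0 : 0 ≤ ρ := by linarith
  have hev := (spectrum.pow_norm_pow_one_div_tendsto_nhds_spectralRadius a).eventually_lt_const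
    (ha.trans_lt (by simpa using hρ1 : (1 : ℝ≥0∞) < ENNReal.ofReal ρ))
  refine Summable.of_norm_bounded_eventually_nat
    (summable_geometric_of_lt_one (mul_nonneg hρ0 hq0) hρq) ?_
  filter_upwards [hev, eventually_gt_atTop 0] with k hk hk0
  rw [ENNReal.ofReal_lt_ofReal_iff (by linarith)] at hk
  have h1 : ‖a ^ k‖ ≤ ρ ^ k := by
    have := pow_le_pow_left₀ (Real.rpow_nonneg (norm_nonneg _) _) hk.le k
    rwa [one_div, Real.rpow_inv_natCast_pow (norm_nonneg _) hk0.ne'] at this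
  rw [mul_pow, Real.norm_of_nonneg (by positivity)]
  gcongr

/-- The Neumann series. It converges even if `‖z⁻¹ • a‖ ≥ 1`, since only the spectral radius
matters. -/
theorem hasSum_resolvent {A : Type*} [NormedRing A] [NormedAlgebra ℂ A] [CompleteSpace A]
    {a : A} (ha : spectralRadius ℂ a ≤ 1) {z : ℂ} (hz : 1 < ‖z‖) :
    HasSum (fun k : ℕ => (z ^ (k + 1))⁻¹ • a ^ k) (resolvent a z) := by
  have hz0 : z ≠ 0 := norm_pos_iff.1 (zero_lt_one.trans hz)
  have hs : Summable fun k : ℕ => (z⁻¹ • a) ^ k := by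
    refine Summable.of_norm ?_
    refine (summable_norm_pow_mul_pow ha (inv_nonneg.2 (norm_nonneg z))
      (inv_lt_one_of_one_lt₀ hz)).congr fun k => ?_
    rw [smul_pow, norm_smul, norm_pow z⁻¹, norm_inv, mul_comm]
  have h1 := hs.one_sub_mul_tsum_pow
  have h2 := hs.tsum_pow_mul_one_sub
  set s := ∑' k, (z⁻¹ • a) ^ k with hsdef
  have hfac : algebraMap ℂ A z - a = z • (1 - z⁻¹ • a) := by
    rw [smul_sub, smul_inv_smul₀ hz0, Algebra.algebraMap_eq_smul_one]
  have hres : resolvent a z = z⁻¹ • s := by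
    let U : Aˣ := ⟨algebraMap ℂ A z - a, z⁻¹ • s,
      by rw [hfac, smul_mul_smul_comm, h1, mul_inv_cancel₀ hz0, one_smul],
      by rw [hfac, smul_mul_smul_comm, h2, inv_mul_cancel₀ hz0, one_smul]⟩
    exact Ring.inverse_unit U
  rw [hres]
  refine (hs.hasSum.const_smul z⁻¹).congr_fun fun k => ?_
  rw [smul_pow, smul_smul, pow_succ', mul_inv, inv_pow]

variable {X : Type*} [NormedAddCommGroup X] [NormedSpace ℂ X] [CompleteSpace X]

/-- The contour integral of `f` against the resolvent is the Taylor series of `f` at `T`. -/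
theorem hasSum_circleIntegral_smul_resolvent {f : ℂ → ℂ} {T : X →L[ℂ] X}
    (hT : spectralRadius ℂ T ≤ 1) {R : ℝ} (hR : 1 < R)
    (hf : AnalyticOnNhd ℂ f (Metric.closedBall 0 R)) :
    HasSum (fun k => taylorCoeff f k • T ^ k)
      ((2 * (Real.pi : ℂ) * Complex.I)⁻¹ • ∮ z in C(0, R), f z • resolvent T z) := by
  have hR0 : 0 < R := zero_lt_one.trans hR
  have hpi : (2 * (Real.pi : ℂ) * Complex.I) ≠ 0 := Complex.two_pi_I_ne_zero
  have hcont : ContinuousOn f (Metric.sphere 0 R) :=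
    hf.continuousOn.mono Metric.sphere_subset_closedBall
  obtain ⟨M, hM⟩ := (isCompact_sphere (0 : ℂ) R).exists_bound_of_continuousOn hcont
  have hint : HasSum (fun k => ∮ z in C(0, R), f z • (z ^ (k + 1))⁻¹ • T ^ k)
      (∮ z in C(0, R), f z • resolvent T z) := by
    -- In the dominating terms `R` comes from the derivative of the circle map and `M` bounds `‖f‖`
    -- on the circle; the rest is `‖T ^ k‖ R⁻¹ ^ (k + 1)`.
    refine intervalIntegral.hasSum_integral_of_dominated_convergence
      (fun k _ => R * (M * (R⁻¹ * (‖T ^ k‖ * R⁻¹ ^ k)))) (fun k => ?_) (fun k => ?_) ?_ ?_ ?_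
    · refine Continuous.aestronglyMeasurable ?_
      simp only [deriv_circleMap]
      have hfc : Continuous fun θ => f (circleMap 0 R θ) :=
        hcont.comp_continuous (continuous_circleMap 0 R)
          fun θ => circleMap_mem_sphere 0 hR0.le θ
      have hic : Continuous fun θ => ((circleMap 0 R θ) ^ (k + 1))⁻¹ :=
        ((continuous_circleMap 0 R).pow _).inv₀
          fun θ => pow_ne_zero _ (circleMap_ne_center hR0.ne')
      exact ((continuous_circleMap 0 R).mul continuous_const).smul
        (hfc.smul (hic.smul continuous_const))
    · refine Eventually.of_forall fun θ _ => ?_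
      have h1 := hM _ (circleMap_mem_sphere 0 hR0.le θ)
      simp only [deriv_circleMap, norm_smul, norm_mul, norm_inv, norm_pow, norm_circleMap_zero,
        Complex.norm_I, mul_one, abs_of_pos hR0]
      rw [pow_succ', mul_inv, inv_pow]
      have : 0 ≤ R⁻¹ * (‖T ^ k‖ * (R ^ k)⁻¹) := by positivity
      calc R * (‖f (circleMap 0 R θ)‖ * (R⁻¹ * (R ^ k)⁻¹ * ‖T ^ k‖))
          = R * (‖f (circleMap 0 R θ)‖ * (R⁻¹ * (‖T ^ k‖ * (R ^ k)⁻¹))) := by ring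
        _ ≤ _ := by gcongr
    · refine Eventually.of_forall fun θ _ => ?_
      exact (((summable_norm_pow_mul_pow hT (by positivity)
        (inv_lt_one_of_one_lt₀ hR)).mul_left _).mul_left _).mul_left _
    · exact intervalIntegrable_const
    · refine Eventually.of_forall fun θ _ => ?_
      refine ((hasSum_resolvent hT ?_).const_smul _).const_smul _
      rwa [norm_circleMap_zero, abs_of_pos hR0]
  refine (hint.const_smul (2 * (Real.pi : ℂ) * Complex.I)⁻¹).congr_fun fun k => ?_
  -- Cauchy's formula for the derivatives at `0` evaluates each term.
  have hc := DiffContOnCl.circleIntegral_one_div_sub_center_pow_smul hR0 k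
    (f := f) (c := 0) ((hf.differentiableOn.mono Metric.closure_ball_subset_closedBall).diffContOnCl)
  simp only [sub_zero, one_div, smul_eq_mul] at hc
  have : (∮ z in C(0, R), f z • (z ^ (k + 1))⁻¹ • T ^ k) =
      (∮ z in C(0, R), (z ^ (k + 1))⁻¹ * f z) • T ^ k := by
    rw [← circleIntegral.integral_smul_const (fun z => (z ^ (k + 1))⁻¹ * f z) (T ^ k)]
    simp only [smul_smul, mul_comm]
  rw [this, hc, smul_smul, taylorCoeff]
  congr 1
  field_simp

theorem hasSum_analyticCalculus {f : ℂ → ℂ} {T : X →L[ℂ] X} (hT : spectralRadius ℂ T ≤ 1)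
    (hf : AnalyticOnNhd ℂ f (Metric.closedBall 0 1)) :
    HasSum (fun k => taylorCoeff f k • T ^ k) (analyticCalculus f T) := by
  have h := exists_one_lt_analyticOnNhd hf
  rw [analyticCalculus, dif_pos h]
  exact hasSum_circleIntegral_smul_resolvent hT h.choose_spec.1 h.choose_spec.2

/-- The Taylor coefficients of a function analytic near the closed unit disk decay geometrically,
so that the Taylor series at `T` converges absolutely. -/
theorem summable_norm_taylorCoeff_mul {f : ℂ → ℂ} {T : X →L[ℂ] X} (hT : spectralRadius ℂ T ≤ 1)
    (hf : AnalyticOnNhd ℂ f (Metric.closedBall 0 1)) :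
    Summable fun k => ‖taylorCoeff f k‖ * ‖T ^ k‖ := by
  obtain ⟨R, hR, hfR⟩ := exists_one_lt_analyticOnNhd hf
  -- The series of `f` converges at `r`, so `‖taylorCoeff f k‖ * r ^ k` is bounded, while `‖T ^ k‖ *
  -- r⁻¹ ^ k` is summable because `r > 1`.
  obtain ⟨r, hr, hrR⟩ := exists_between hR
  have hr0 : 0 < r := zero_lt_one.trans hr
  have hs := (hasSum_taylorCoeff hfR (z := r)
    (by rwa [Complex.norm_real, Real.norm_of_nonneg hr0.le])).summable
  obtain ⟨M, hM⟩ := (Metric.isBounded_range_of_tendsto _ hs.tendsto_atTop_zero).exists_norm_le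
  refine Summable.of_nonneg_of_le (fun k => by positivity) (fun k => ?_)
    ((summable_norm_pow_mul_pow hT (inv_nonneg.2 hr0.le) (inv_lt_one_of_one_lt₀ hr)).mul_left M)
  have h1 := hM _ ⟨k, rfl⟩
  rw [norm_mul, norm_pow, Complex.norm_real, Real.norm_of_nonneg hr0.le] at h1
  calc ‖taylorCoeff f k‖ * ‖T ^ k‖ = (‖taylorCoeff f k‖ * r ^ k) * (‖T ^ k‖ * r⁻¹ ^ k) := by
        rw [mul_mul_mul_comm, mul_assoc, ← mul_pow, mul_inv_cancel₀ hr0.ne',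
          one_pow, mul_one]
    _ ≤ _ := by gcongr

end Calculus

/-! ### Weighted averages of the orbits of a positive operator -/

theorem norm_le_norm_of_nonneg_of_le {F : Type*} [NormedAddCommGroup F] [Lattice F]
    [IsOrderedAddMonoid F] [HasSolidNorm F] {x y : F} (hx : 0 ≤ x) (hxy : x ≤ y) : ‖x‖ ≤ ‖y‖ :=
  HasSolidNorm.solid (by rwa [abs_of_nonneg hx, abs_of_nonneg (hx.trans hxy)])

theorem ContinuousLinearMap.pow_nonneg_of_nonneg {F : Type*} [NormedAddCommGroup F]
    [NormedSpace ℝ F] [Lattice F] {S : F →L[ℝ] F} (hS : ∀ x, 0 ≤ x → 0 ≤ S x) (k : ℕ) {x : F}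
    (hx : 0 ≤ x) : 0 ≤ (S ^ k) x := by
  induction k with
  | zero => simpa
  | succ k ih => rw [pow_succ']; exact hS _ ih

theorem ContinuousLinearMap.pow_apply_mono {F : Type*} [NormedAddCommGroup F]
    [NormedSpace ℝ F] [Lattice F] [IsOrderedAddMonoid F] {S : F →L[ℝ] F}
    (hS : ∀ x, 0 ≤ x → 0 ≤ S x) {u : F} (hu : u ≤ S u) : Monotone fun k : ℕ => (S ^ k) u := by
  refine monotone_nat_of_le_succ fun k => ?_
  have := pow_nonneg_of_nonneg hS k (sub_nonneg.2 hu)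
  rwa [map_sub, sub_nonneg, ← mul_apply_eq_comp, ← pow_succ] at this

section Weights

variable {F : Type*} [NormedAddCommGroup F] [NormedSpace ℝ F]

/-- The average `∑ b_k S^k x` of the orbit of `x` under `S`. -/
noncomputable def orbitAverage (S : F →L[ℝ] F) (b : ℕ → ℝ) (x : F) : F :=
  ∑' k, b k • (S ^ k) x

/-- A probability weight `b` on `ℕ` for which `∑ b_k S^k` converges absolutely, with norm at
most `C`. -/
structure IsBoundedWeight (S : F →L[ℝ] F) (C : ℝ) (b : ℕ → ℝ) : Prop where
  nonneg : ∀ k, 0 ≤ b k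
  hasSum_one : HasSum b 1
  summable_mul_norm : Summable fun k => b k * ‖S ^ k‖
  norm_orbitAverage_le : ∀ x, ‖orbitAverage S b x‖ ≤ C * ‖x‖

namespace IsBoundedWeight

open ContinuousLinearMap (pow_nonneg_of_nonneg pow_apply_mono)

variable {S : F →L[ℝ] F} {C : ℝ} {b : ℕ → ℝ}

theorem le_one (hb : IsBoundedWeight S C b) (k : ℕ) : b k ≤ 1 :=
  le_hasSum hb.hasSum_one k fun i _ => hb.nonneg i

theorem summable_mul_norm_apply (hb : IsBoundedWeight S C b) (x : F) :
    Summable fun k => b k * ‖(S ^ k) x‖ := by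
  refine Summable.of_nonneg_of_le (fun k => mul_nonneg (hb.nonneg k) (norm_nonneg _)) (fun k => ?_)
    (hb.summable_mul_norm.mul_right ‖x‖)
  rw [mul_assoc]
  exact mul_le_mul_of_nonneg_left ((S ^ k).le_opNorm x) (hb.nonneg k)

theorem norm_smul_apply (hb : IsBoundedWeight S C b) (x : F) (k : ℕ) :
    ‖b k • (S ^ k) x‖ = b k * ‖(S ^ k) x‖ := by
  rw [norm_smul, Real.norm_of_nonneg (hb.nonneg k)]

theorem norm_orbitAverage_le_tsum (hb : IsBoundedWeight S C b) (x : F) :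
    ‖orbitAverage S b x‖ ≤ ∑' k, b k * ‖(S ^ k) x‖ := by
  have h := norm_tsum_le_tsum_norm (f := fun k => b k • (S ^ k) x)
    (by simpa only [hb.norm_smul_apply] using hb.summable_mul_norm_apply x)
  simpa only [hb.norm_smul_apply, orbitAverage] using h

/-- The indices below `N` are controlled by the uniform bound `ε` on the weights, the others by the
total mass `1`. -/
theorem norm_orbitAverage_le_add (hb : IsBoundedWeight S C b) {ε η : ℝ} (hε : ∀ k, b k ≤ ε)
    {x : F} {N : ℕ} (hN : ∀ k, N ≤ k → ‖(S ^ k) x‖ ≤ η) (hη : 0 ≤ η) :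
    ‖orbitAverage S b x‖ ≤ η + ε * ∑ k ∈ Finset.range N, ‖(S ^ k) x‖ := by
  refine (hb.norm_orbitAverage_le_tsum x).trans ?_
  have h1 : HasSum (fun k => if k ∈ Finset.range N then ε * ‖(S ^ k) x‖ else 0)
      (∑ k ∈ Finset.range N, ε * ‖(S ^ k) x‖) := by
    have := hasSum_sum_of_ne_finset_zero (L := .unconditional ℕ) (s := Finset.range N)
      (f := fun k => if k ∈ Finset.range N then ε * ‖(S ^ k) x‖ else 0)
      (fun k hk => if_neg hk)
    rwa [Finset.sum_congr rfl fun k hk => if_pos hk] at this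
  rw [Finset.mul_sum]
  refine hasSum_le (fun k => ?_) (hb.summable_mul_norm_apply x).hasSum
    (((hb.hasSum_one.mul_left η).add h1).congr_fun fun _ => rfl) |>.trans_eq (by rw [mul_one])
  by_cases hk : k < N
  · simp only [Finset.mem_range, hk, if_true]
    have h2 := mul_le_mul_of_nonneg_right (hε k) (norm_nonneg ((S ^ k) x))
    have h3 := mul_nonneg hη (hb.nonneg k)
    linarith
  · simp only [Finset.mem_range, hk, if_false, add_zero]
    rw [mul_comm]
    exact mul_le_mul_of_nonneg_right (hN k (not_lt.1 hk)) (hb.nonneg k)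

theorem tendsto_orbitAverage_of_tendsto_pow {b : ℕ → ℕ → ℝ}
    (hb : ∀ m, IsBoundedWeight S C (b m)) {ε : ℕ → ℝ} (hε : ∀ m k, b m k ≤ ε m)
    (hlim : Tendsto ε atTop (𝓝 0)) {x : F}
    (hx : Tendsto (fun k : ℕ => (S ^ k) x) atTop (𝓝 0)) :
    Tendsto (fun m => orbitAverage S (b m) x) atTop (𝓝 0) := by
  rw [Metric.tendsto_atTop] at hx
  rw [tendsto_zero_iff_norm_tendsto_zero]
  refine tendsto_order.2 ⟨fun c hc => Eventually.of_forall fun m => hc.trans_le (norm_nonneg _),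
    fun c hc => ?_⟩
  obtain ⟨N, hN⟩ := hx (c / 2) (half_pos hc)
  have h := (hlim.mul_const (∑ k ∈ Finset.range N, ‖(S ^ k) x‖))
  rw [zero_mul] at h
  filter_upwards [h.eventually_lt_const (half_pos hc)] with m hm
  have := (hb m).norm_orbitAverage_le_add (hε m) (x := x) (N := N) (η := c / 2)
    (fun k hk => by simpa using (hN k hk).le) (half_pos hc).le
  linarith

variable [CompleteSpace F]

theorem hasSum (hb : IsBoundedWeight S C b) (x : F) :
    HasSum (fun k => b k • (S ^ k) x) (orbitAverage S b x) := by
  refine (Summable.of_norm ?_).hasSum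
  simpa only [hb.norm_smul_apply] using hb.summable_mul_norm_apply x

theorem orbitAverage_add (hb : IsBoundedWeight S C b) (x y : F) :
    orbitAverage S b (x + y) = orbitAverage S b x + orbitAverage S b y := by
  refine (((hb.hasSum x).add (hb.hasSum y)).congr_fun fun k => ?_).unique (hb.hasSum _) |>.symm
  rw [map_add, smul_add]

theorem orbitAverage_smul (hb : IsBoundedWeight S C b) (c : ℝ) (x : F) :
    orbitAverage S b (c • x) = c • orbitAverage S b x := by
  refine (((hb.hasSum x).const_smul c).congr_fun fun k => ?_).unique (hb.hasSum _) |>.symm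
  rw [map_smul, smul_comm]

theorem orbitAverage_map (hb : IsBoundedWeight S C b) (x : F) :
    orbitAverage S b (S x) = S (orbitAverage S b x) := by
  refine (((hb.hasSum x).mapL S).congr_fun fun k => ?_).unique (hb.hasSum _) |>.symm
  rw [map_smul, ← mul_apply_eq_comp, ← mul_apply_eq_comp, ← pow_succ,
    ← pow_succ']

theorem convexCombination (hb : IsBoundedWeight S C b) {a : ℕ → ℝ} (ha : IsBoundedWeight S C a)
    {t s : ℝ} (ht : 0 ≤ t) (hs : 0 ≤ s) (hts : t + s = 1) :
    IsBoundedWeight S C fun k => t * b k + s * a k where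
  nonneg k := add_nonneg (mul_nonneg ht (hb.nonneg k)) (mul_nonneg hs (ha.nonneg k))
  hasSum_one := by
    simpa [hts] using (hb.hasSum_one.mul_left t).add (ha.hasSum_one.mul_left s)
  summable_mul_norm :=
    ((hb.summable_mul_norm.mul_left t).add (ha.summable_mul_norm.mul_left s)).congr
      fun k => by ring
  norm_orbitAverage_le x := by
    have h : orbitAverage S (fun k => t * b k + s * a k) x =
        t • orbitAverage S b x + s • orbitAverage S a x := by
      refine HasSum.tsum_eq ((((hb.hasSum x).const_smul t).add
        ((ha.hasSum x).const_smul s)).congr_fun fun k => ?_)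
      rw [add_smul, mul_smul, mul_smul]
    rw [h]
    refine (norm_add_le _ _).trans ?_
    rw [norm_smul, norm_smul, Real.norm_of_nonneg ht, Real.norm_of_nonneg hs]
    calc t * ‖orbitAverage S b x‖ + s * ‖orbitAverage S a x‖
        ≤ t * (C * ‖x‖) + s * (C * ‖x‖) := by
          gcongr
          · exact hb.norm_orbitAverage_le x
          · exact ha.norm_orbitAverage_le x
      _ = C * ‖x‖ := by rw [← add_mul, hts, one_mul]

/-- If bounded weights tend to `0` pointwise, then convex combinations of them tend to `0`
uniformly. -/
theorem exists_le {J : Type*} {l : Filter J} [l.NeBot] {a : J → ℕ → ℝ}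
    (ha : ∀ j, IsBoundedWeight S C (a j)) (hlim : ∀ k, Tendsto (fun j => a j k) l (𝓝 0)) (n : ℕ) :
    ∃ b, IsBoundedWeight S C b ∧ ∀ k, b k ≤ 2 / ((n : ℝ) + 2) := by
  induction n with
  | zero =>
    -- For `n = 0` the bound is `1`, which every probability weight satisfies.
    obtain ⟨j⟩ := l.nonempty_of_neBot
    exact ⟨a j, ha j, fun k => by simpa using (ha j).le_one k⟩
  | succ n ih =>
    -- Only finitely many `k` have `b k ≥ δ`, and some `a j` is below `δ` at all of them; so at each
    -- `k` at least one of the two weights is below `δ`.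
    obtain ⟨b, hb, hbn⟩ := ih
    push_cast
    set δ : ℝ := 2 / ((n : ℝ) + 1 + 2) - 2 / ((n : ℝ) + 4) with hδ
    have hn : (0 : ℝ) ≤ n := n.cast_nonneg
    have hδ0 : 0 < δ :=
      sub_pos.2 (div_lt_div_of_pos_left two_pos (by linarith) (by linarith))
    have hfin : {k | ¬ b k < δ}.Finite := by
      simpa using (hb.hasSum_one.summable.tendsto_cofinite_zero.eventually_lt_const hδ0)
    obtain ⟨j, hj⟩ := ((eventually_all_finite hfin).2
      fun k _ => (hlim k).eventually_lt_const hδ0).exists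
    -- The coefficients balance the two worst cases: `b k = 2 / (n + 2)` and `a j k = 1` each
    -- contribute exactly `2 / (n + 4)`. The other summand is at most `δ`, the gap up to the new
    -- bound `2 / (n + 3)`.
    have hs0 : (0 : ℝ) ≤ 2 / (n + 4) := by positivity
    have ht0 : (0 : ℝ) ≤ (n + 2) / (n + 4) := by positivity
    have hts : ((n : ℝ) + 2) / (n + 4) + 2 / (n + 4) = 1 := by field_simp; ring
    refine ⟨_, hb.convexCombination (ha j) ht0 hs0 hts, fun k => ?_⟩
    have hgoal : 2 / ((n : ℝ) + 1 + 2) = 2 / ((n : ℝ) + 4) + δ := by rw [hδ]; ring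
    rw [hgoal]
    have hδt : ((n : ℝ) + 2) / (n + 4) * δ ≤ δ := mul_le_of_le_one_left hδ0.le (by linarith)
    have hδs : 2 / ((n : ℝ) + 4) * δ ≤ δ := mul_le_of_le_one_left hδ0.le (by linarith)
    by_cases hk : b k < δ
    · have h1 := mul_le_mul_of_nonneg_left hk.le ht0
      have h2 := mul_le_mul_of_nonneg_left ((ha j).le_one k) hs0
      linarith
    · have h1 := mul_le_mul_of_nonneg_left (hbn k) ht0
      have h2 := mul_le_mul_of_nonneg_left (hj k hk).le hs0
      have h3 : ((n : ℝ) + 2) / (n + 4) * (2 / (n + 2)) = 2 / (n + 4) := by field_simp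
      linarith

/-! ### Order estimates for averages of increasing orbits -/

variable [Lattice F] [IsOrderedAddMonoid F] [IsOrderedModule ℝ F] [HasSolidNorm F]

theorem orbitAverage_nonneg (hb : IsBoundedWeight S C b) (hS : ∀ x, 0 ≤ x → 0 ≤ S x) {x : F}
    (hx : 0 ≤ x) : 0 ≤ orbitAverage S b x :=
  HasSum.nonneg (fun k => smul_nonneg (hb.nonneg k) (pow_nonneg_of_nonneg hS k hx)) (hb.hasSum x)

theorem orbitAverage_mono (hb : IsBoundedWeight S C b) (hS : ∀ x, 0 ≤ x → 0 ≤ S x) {x y : F}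
    (hxy : x ≤ y) : orbitAverage S b x ≤ orbitAverage S b y := by
  have h := hb.orbitAverage_nonneg hS (sub_nonneg.2 hxy)
  have h2 := hb.orbitAverage_add (y - x) x
  rw [sub_add_cancel] at h2
  rw [h2]
  exact le_add_of_nonneg_left h

theorem le_orbitAverage (hb : IsBoundedWeight S C b) (hS : ∀ x, 0 ≤ x → 0 ≤ S x) {u : F}
    (hu : u ≤ S u) : u ≤ orbitAverage S b u := by
  have h := hb.hasSum_one.smul_const u
  rw [one_smul] at h
  exact hasSum_le (fun k => smul_le_smul_of_nonneg_left (pow_apply_mono hS hu (Nat.zero_le k))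
    (hb.nonneg k)) h (hb.hasSum u)

/-- The indices below `n` carry mass at most `n * ε ≤ 1 / 2`. At least half of the mass remains on
`k ≥ n`, where `S^k u ≥ S^n u`. -/
theorem half_smul_pow_apply_le (hb : IsBoundedWeight S C b) (hS : ∀ x, 0 ≤ x → 0 ≤ S x) {u : F}
    (hu0 : 0 ≤ u) (hu : u ≤ S u) {ε : ℝ} (hε : ∀ k, b k ≤ ε) {n : ℕ} (hn : n * ε ≤ 1 / 2) :
    (1 / 2 : ℝ) • (S ^ n) u ≤ orbitAverage S b u := by
  have hSn := pow_nonneg_of_nonneg hS n hu0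
  have h1 : HasSum (fun k => if k ∈ Finset.range n then b k else 0)
      (∑ k ∈ Finset.range n, b k) := by
    have := hasSum_sum_of_ne_finset_zero (L := .unconditional ℕ) (s := Finset.range n)
      (f := fun k => if k ∈ Finset.range n then b k else 0) (fun k hk => if_neg hk)
    rwa [Finset.sum_congr rfl fun k hk => if_pos hk] at this
  have h2 : ∑ k ∈ Finset.range n, b k ≤ 1 / 2 := by
    refine (Finset.sum_le_card_nsmul _ _ ε fun k _ => hε k).trans ?_
    simpa using hn
  refine le_trans (smul_le_smul_of_nonneg_right (by linarith : (1 / 2 : ℝ) ≤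
    1 - ∑ k ∈ Finset.range n, b k) hSn) ?_
  refine hasSum_le (fun k => ?_) ((hb.hasSum_one.sub h1).smul_const _) (hb.hasSum u)
  by_cases hk : k < n
  · simp only [Finset.mem_range, hk, if_true, sub_self, zero_smul]
    exact smul_nonneg (hb.nonneg k) (pow_nonneg_of_nonneg hS k hu0)
  · simp only [Finset.mem_range, hk, if_false, sub_zero]
    exact smul_le_smul_of_nonneg_left (pow_apply_mono hS hu (not_lt.1 hk)) (hb.nonneg k)

theorem norm_orbitAverage_sub_le (hb : IsBoundedWeight S C b) (hS : ∀ x, 0 ≤ x → 0 ≤ S x) {u : F}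
    (hu : u ≤ S u) {ε M : ℝ} (hε : ∀ k, b k ≤ ε) (hM : ∀ n : ℕ, ‖(S ^ n) u - u‖ ≤ M) :
    ‖orbitAverage S b (S u - u)‖ ≤ ε * M := by
  have hy : 0 ≤ S u - u := sub_nonneg.2 hu
  have hε0 : 0 ≤ ε := (hb.nonneg 0).trans (hε 0)
  refine le_of_tendsto' (hb.hasSum (S u - u)).tendsto_sum_nat.norm fun n => ?_
  have htel : ∑ k ∈ Finset.range n, (S ^ k) (S u - u) = (S ^ n) u - u := by
    refine Eq.trans ?_ (Finset.sum_range_sub (fun k => (S ^ k) u) n)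
    refine Finset.sum_congr rfl fun k _ => ?_
    rw [map_sub, ← mul_apply_eq_comp, ← pow_succ]
  -- The increments are positive, so every weight may be raised to `ε`, and only then does the sum
  -- telescope.
  have hle : ∑ k ∈ Finset.range n, b k • (S ^ k) (S u - u) ≤ ε • ((S ^ n) u - u) := by
    rw [← htel, Finset.smul_sum]
    exact Finset.sum_le_sum fun k _ =>
      smul_le_smul_of_nonneg_right (hε k) (pow_nonneg_of_nonneg hS k hy)
  have h0 : 0 ≤ ∑ k ∈ Finset.range n, b k • (S ^ k) (S u - u) :=
    Finset.sum_nonneg fun k _ => smul_nonneg (hb.nonneg k) (pow_nonneg_of_nonneg hS k hy)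
  refine (norm_le_norm_of_nonneg_of_le h0 hle).trans ?_
  rw [norm_smul, Real.norm_of_nonneg hε0]
  exact mul_le_mul_of_nonneg_left (hM n) hε0

/-- For fixed `n`, choosing `m` with `n * ε m < 1 / 2` gives a bound independent of `n`. -/
theorem norm_pow_apply_le {b : ℕ → ℕ → ℝ} (hb : ∀ m, IsBoundedWeight S C (b m)) {ε : ℕ → ℝ}
    (hε : ∀ m k, b m k ≤ ε m) (hlim : Tendsto ε atTop (𝓝 0)) (hS : ∀ x, 0 ≤ x → 0 ≤ S x) {u : F}
    (hu0 : 0 ≤ u) (hu : u ≤ S u) (n : ℕ) : ‖(S ^ n) u‖ ≤ 2 * (C * ‖u‖) := by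
  have h := hlim.const_mul (n : ℝ)
  rw [mul_zero] at h
  obtain ⟨m, hm⟩ := (h.eventually_lt_const one_half_pos).exists
  have h1 := norm_le_norm_of_nonneg_of_le
    (smul_nonneg one_half_pos.le (pow_nonneg_of_nonneg hS n hu0))
    ((hb m).half_smul_pow_apply_le hS hu0 hu (hε m) hm.le)
  rw [norm_smul, Real.norm_of_nonneg one_half_pos.le] at h1
  have h2 := (hb m).norm_orbitAverage_le u
  linarith

theorem tendsto_orbitAverage_sub {b : ℕ → ℕ → ℝ} (hb : ∀ m, IsBoundedWeight S C (b m))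
    {ε : ℕ → ℝ} (hε : ∀ m k, b m k ≤ ε m) (hlim : Tendsto ε atTop (𝓝 0))
    (hS : ∀ x, 0 ≤ x → 0 ≤ S x) {u : F} (hu0 : 0 ≤ u) (hu : u ≤ S u) :
    Tendsto (fun m => orbitAverage S (b m) (S u - u)) atTop (𝓝 0) := by
  have h := hlim.mul_const (2 * (C * ‖u‖) + ‖u‖)
  rw [zero_mul] at h
  refine squeeze_zero_norm (fun m => ?_) h
  exact (hb m).norm_orbitAverage_sub_le hS hu (hε m) fun n =>
    (norm_sub_le _ _).trans (add_le_add (norm_pow_apply_le hb hε hlim hS hu0 hu n) le_rfl)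

end IsBoundedWeight

end Weights

/-! ### The real operator behind a positive operator -/

namespace Complexification

theorem ofReal_add {F : Type*} [AddCommGroup F] (x y : F) :
    ofReal (x + y) = ofReal x + ofReal y := by
  ext <;> simp [ofReal]

theorem ofReal_sub {F : Type*} [AddCommGroup F] (x y : F) :
    ofReal (x - y) = ofReal x - ofReal y := by
  ext <;> simp [ofReal]

theorem ofReal_smul {F : Type*} [AddCommGroup F] [Module ℝ F] (c : ℝ) (x : F) :
    ofReal (c • x) = (c : ℂ) • ofReal x := by
  ext <;> simp only [ofReal, smul_re, smul_im, Complex.ofReal_re, Complex.ofReal_im] <;> simp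

theorem eq_ofReal_add_smul {F : Type*} [AddCommGroup F] [Module ℝ F] (z : Complexification F) :
    z = ofReal z.re + Complex.I • ofReal z.im := by
  ext <;> simp [ofReal]

variable {F : Type*} [NormedAddCommGroup F] [NormedSpace ℝ F] [Lattice F]
  [IsOrderedAddMonoid F] [IsOrderedModule ℝ F] [HasSolidNorm F] [CompleteSpace F]

theorem modulus_ofReal (x : F) : (ofReal x).modulus = |x| :=
  le_antisymm (by simpa [ofReal] using modulus_le_add (ofReal x))
    (abs_re_le_modulus (ofReal x))

theorem norm_ofReal (x : F) : ‖ofReal x‖ = ‖x‖ := by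
  rw [norm_def, modulus_ofReal, norm_abs_eq_norm]

theorem modulus_eq_zero {z : Complexification F} (h : z.modulus = 0) : z = 0 := by
  rw [← norm_eq_zero, norm_def, h, norm_zero]

/-- Taking real parts, as an additive map. -/
noncomputable def reAddHom : Complexification F →+ F where
  toFun z := z.re
  map_zero' := rfl
  map_add' _ _ := rfl

theorem continuous_reAddHom : Continuous (reAddHom : Complexification F →+ F) :=
  AddMonoidHomClass.continuous_of_bound _ 1 fun z => by
    rw [one_mul]
    exact norm_re_le z

/-- The operator `x ↦ Re (T x)` on the real part. -/
noncomputable def realOp (T : Complexification F →L[ℂ] Complexification F) : F →L[ℝ] F :=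
  LinearMap.mkContinuous
    { toFun := fun x => (T (ofReal x)).re
      map_add' := fun x y => by rw [ofReal_add, map_add, add_re]
      map_smul' := fun c x => by
        rw [ofReal_smul, map_smul, smul_re, Complex.ofReal_re, Complex.ofReal_im, zero_smul,
          sub_zero, RingHom.id_apply] }
    ‖T‖ fun x => (norm_re_le _).trans ((T.le_opNorm _).trans_eq (by rw [norm_ofReal]))

variable {T : Complexification F →L[ℂ] Complexification F}

theorem IsPositiveOp.realOp_nonneg (hT : IsPositiveOp T) (x : F) (hx : 0 ≤ x) : 0 ≤ realOp T x :=
  (hT (ofReal x) rfl hx).2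

/-- Positivity speaks of the cone only; the splitting `x = x⁺ - x⁻` extends reality of `T` to all of
`F`. -/
theorem IsPositiveOp.apply_ofReal (hT : IsPositiveOp T) (x : F) :
    T (ofReal x) = ofReal (realOp T x) := by
  refine Complexification.ext rfl ?_
  have h : ofReal x = ofReal x⁺ - ofReal x⁻ := by rw [← ofReal_sub, posPart_sub_negPart]
  rw [h, map_sub, sub_im, (hT _ rfl (posPart_nonneg x)).1, (hT _ rfl (negPart_nonneg x)).1,
    sub_zero]
  rfl

theorem IsPositiveOp.pow_apply_ofReal (hT : IsPositiveOp T) (k : ℕ) (x : F) :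
    (T ^ k) (ofReal x) = ofReal ((realOp T ^ k) x) := by
  induction k with
  | zero => simp
  | succ k ih => rw [pow_succ', pow_succ', mul_apply_eq_comp, mul_apply_eq_comp, ih,
      hT.apply_ofReal]

theorem IsPositiveOp.norm_realOp_pow_le (hT : IsPositiveOp T) (k : ℕ) :
    ‖realOp T ^ k‖ ≤ ‖T ^ k‖ :=
  ContinuousLinearMap.opNorm_le_bound _ (norm_nonneg _) fun x => by
    rw [← norm_ofReal, ← hT.pow_apply_ofReal, ← norm_ofReal x]
    exact (T ^ k).le_opNorm _

/-- `T` acts as `realOp T` on real and imaginary parts, hence commutes with every `rotRe`, and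
`realOp T` preserves the upper bound `rotRe z θ ≤ |z|`. -/
theorem IsPositiveOp.modulus_apply_le (hT : IsPositiveOp T) (z : Complexification F) :
    (T z).modulus ≤ realOp T z.modulus := by
  have hz : T z = ⟨realOp T z.re, realOp T z.im⟩ := by
    conv_lhs => rw [eq_ofReal_add_smul z, map_add, map_smul, hT.apply_ofReal, hT.apply_ofReal]
    exact (eq_ofReal_add_smul ⟨realOp T z.re, realOp T z.im⟩).symm
  refine (isLUB_modulus (T z)).2 ?_
  rintro _ ⟨θ, rfl⟩
  have h : (T z).rotRe θ = realOp T (z.rotRe θ) := by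
    rw [hz, rotRe, rotRe, map_add, map_smul, map_smul]
  rw [h, ← sub_nonneg, ← map_sub]
  exact hT.realOp_nonneg _ (sub_nonneg.2 (rotRe_le_modulus z θ))

/-! ### The ideal of elements with vanishing orbit averages -/

/-- The elements `z` for which the averages of the orbit of `|z|` tend to `0`. -/
noncomputable def nullIdeal {S : F →L[ℝ] F} {C : ℝ} (hS : ∀ x, 0 ≤ x → 0 ≤ S x) {b : ℕ → ℕ → ℝ}
    (hb : ∀ m, IsBoundedWeight S C (b m)) : Submodule ℂ (Complexification F) where
  carrier := {z | Tendsto (fun m => orbitAverage S (b m) z.modulus) atTop (𝓝 0)}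
  zero_mem' := by
    have h : ∀ m, orbitAverage S (b m) (0 : Complexification F).modulus = 0 := fun m => by
      simp [modulus_zero, orbitAverage]
    simp [h]
  add_mem' {z w} hz hw := by
    have h := Tendsto.add hz hw
    rw [add_zero] at h
    refine squeeze_zero_norm (fun m => ?_) (tendsto_zero_iff_norm_tendsto_zero.1 h)
    rw [← (hb m).orbitAverage_add]
    exact norm_le_norm_of_nonneg_of_le ((hb m).orbitAverage_nonneg hS (modulus_nonneg _))
      ((hb m).orbitAverage_mono hS (modulus_add_le z w))
  smul_mem' c z hz := by
    have h := Tendsto.const_smul hz ‖c‖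
    rw [smul_zero] at h
    refine h.congr fun m => ?_
    rw [modulus_smul, (hb m).orbitAverage_smul]

variable {S : F →L[ℝ] F} {C : ℝ} (hS : ∀ x, 0 ≤ x → 0 ≤ S x) {b : ℕ → ℕ → ℝ}
    (hb : ∀ m, IsBoundedWeight S C (b m))

theorem mem_nullIdeal {z : Complexification F} :
    z ∈ nullIdeal hS hb ↔ Tendsto (fun m => orbitAverage S (b m) z.modulus) atTop (𝓝 0) :=
  Iff.rfl

theorem mem_nullIdeal_of_modulus_le {z : Complexification F} {x : F} (hzx : z.modulus ≤ x)
    (hx : Tendsto (fun m => orbitAverage S (b m) x) atTop (𝓝 0)) : z ∈ nullIdeal hS hb :=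
  squeeze_zero_norm (fun m => norm_le_norm_of_nonneg_of_le
    ((hb m).orbitAverage_nonneg hS (modulus_nonneg z)) ((hb m).orbitAverage_mono hS hzx))
    (tendsto_zero_iff_norm_tendsto_zero.1 hx)

theorem isLatticeIdeal_nullIdeal : IsLatticeIdeal (nullIdeal hS hb) :=
  fun _ _ hw hzw => mem_nullIdeal_of_modulus_le hS hb hzw hw

theorem isClosed_nullIdeal : IsClosed (nullIdeal hS hb : Set (Complexification F)) := by
  refine isClosed_of_closure_subset fun z hz => ?_
  rw [Metric.mem_closure_iff] at hz
  refine tendsto_zero_iff_norm_tendsto_zero.2 (tendsto_order.2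
    ⟨fun c hc => Eventually.of_forall fun m => hc.trans_le (norm_nonneg _), fun c hc => ?_⟩)
  -- With this distance the average of `|z - w|` has norm below `c / 2` for all `m` at once; `|C| +
  -- 1` keeps the denominator positive.
  obtain ⟨w, hw, hzw⟩ := hz (c / 2 / (|C| + 1)) (by positivity)
  rw [lt_div_iff₀ (by positivity), dist_eq_norm, norm_def] at hzw
  filter_upwards [(tendsto_zero_iff_norm_tendsto_zero.1 hw).eventually_lt_const (half_pos hc)]
    with m hm
  have h1 : z.modulus ≤ (z - w).modulus + w.modulus := by
    simpa using modulus_add_le (z - w) w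
  have h2 := norm_le_norm_of_nonneg_of_le ((hb m).orbitAverage_nonneg hS (modulus_nonneg z))
    ((hb m).orbitAverage_mono hS h1)
  rw [(hb m).orbitAverage_add] at h2
  have h3 := h2.trans (norm_add_le _ _)
  have h4 := (hb m).norm_orbitAverage_le (z - w).modulus
  have h5 := mul_le_mul_of_nonneg_right (le_abs_self C) (norm_nonneg (z - w).modulus)
  have h6 := norm_nonneg (z - w).modulus
  linarith

theorem IsPositiveOp.apply_mem_nullIdeal (hT : IsPositiveOp T)
    (hb : ∀ m, IsBoundedWeight (realOp T) C (b m)) {z : Complexification F}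
    (hz : z ∈ nullIdeal hT.realOp_nonneg hb) : T z ∈ nullIdeal hT.realOp_nonneg hb := by
  refine mem_nullIdeal_of_modulus_le _ hb (hT.modulus_apply_le z) ?_
  have h := ((realOp T).continuous.tendsto 0).comp hz
  rw [map_zero] at h
  exact h.congr fun m => ((hb m).orbitAverage_map _).symm

/-! ### Weighting schemes give bounded weights -/

theorem IsPositiveOp.isBoundedWeight_taylorCoeff (hT : IsPositiveOp T)
    (hr : spectralRadius ℂ T ≤ 1) {f : ℂ → ℂ} (hf : AnalyticOnNhd ℂ f (Metric.closedBall 0 1))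
    (hf1 : f 1 = 1)
    (hd : ∀ k, 0 ≤ (iteratedDeriv k f 0).re ∧ (iteratedDeriv k f 0).im = 0) {C : ℝ}
    (hC : ‖analyticCalculus f T‖ ≤ C) :
    IsBoundedWeight (realOp T) C (fun k => (taylorCoeff f k).re) := by
  have hcoeff := re_taylorCoeff_nonneg hd
  have hreal := ofReal_re_taylorCoeff hd
  obtain ⟨R, hR, hfR⟩ := exists_one_lt_analyticOnNhd hf
  refine ⟨hcoeff, ?_, ?_, fun x => ?_⟩
  · have h := hasSum_taylorCoeff hfR (z := 1) (by simpa using hR)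
    simpa [hf1] using Complex.hasSum_re h
  · refine Summable.of_nonneg_of_le (fun k => mul_nonneg (hcoeff k) (norm_nonneg _)) (fun k => ?_)
      (summable_norm_taylorCoeff_mul hr hf)
    exact mul_le_mul ((le_abs_self _).trans (Complex.abs_re_le_norm _)) (hT.norm_realOp_pow_le k)
      (norm_nonneg _) (norm_nonneg _)
  -- On real vectors the orbit average is the real part of `f(T)` applied to the vector, so it
  -- inherits the bound `C`.
  · have h1 : HasSum (fun k => taylorCoeff f k • (T ^ k) (ofReal x))
        (analyticCalculus f T (ofReal x)) :=
      (hasSum_analyticCalculus hr hf).mapL (ContinuousLinearMap.apply ℂ _ (ofReal x))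
    have h2 : HasSum (fun k => (taylorCoeff f k).re • (realOp T ^ k) x)
        (analyticCalculus f T (ofReal x)).re := by
      refine (h1.map reAddHom continuous_reAddHom).congr_fun fun k => ?_
      rw [Function.comp_apply, hT.pow_apply_ofReal, ← hreal k, ← ofReal_smul, Complex.ofReal_re]
      rfl
    rw [orbitAverage, h2.tsum_eq]
    refine (norm_re_le _).trans ((ContinuousLinearMap.le_opNorm _ _).trans ?_)
    rw [norm_ofReal]
    exact mul_le_mul_of_nonneg_right hC (norm_nonneg x)

end Complexification

/-- All terms of the series at `1/2` are nonnegative, so the `k`-th coefficient is at most `2 ^ k *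
‖f j (1/2)‖`. -/
theorem IsWeightingScheme.tendsto_taylorCoeff {J : Type*} [Preorder J] {f : J → ℂ → ℂ}
    (hf : IsWeightingScheme f) (k : ℕ) :
    Tendsto (fun j => (taylorCoeff (f j) k).re) atTop (𝓝 0) := by
  have h := (hf.tendsto_zero (1 / 2 : ℝ) (by
    rw [Complex.norm_real]; norm_num)).mul_const ((2 : ℝ) ^ k)
  rw [zero_mul] at h
  refine squeeze_zero (fun j => re_taylorCoeff_nonneg (hf.deriv_nonneg j) k) (fun j => ?_) h
  have hs := Complex.hasSum_re (hasSum_taylorCoeff (hf.analytic j) (z := (1 / 2 : ℝ)) (by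
    rw [Complex.norm_real]; norm_num))
  have hterm : ∀ i, (taylorCoeff (f j) i * ((1 / 2 : ℝ) : ℂ) ^ i).re =
      (taylorCoeff (f j) i).re * (1 / 2) ^ i := fun i => by
    rw [← Complex.ofReal_pow, Complex.re_mul_ofReal]
  simp only [hterm] at hs
  have hle := le_hasSum hs k fun i _ =>
    mul_nonneg (re_taylorCoeff_nonneg (hf.deriv_nonneg j) i) (by positivity)
  have h2 := mul_le_mul_of_nonneg_right (hle.trans ((le_abs_self _).trans
    (Complex.abs_re_le_norm _))) (by positivity : (0 : ℝ) ≤ 2 ^ k)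
  rwa [mul_assoc, ← mul_pow, one_div_mul_cancel two_ne_zero, one_pow, mul_one] at h2

theorem mainTheorem7 {F : Type u} [NormedAddCommGroup F] [NormedSpace ℝ F] [Lattice F]
    [IsOrderedAddMonoid F] [IsOrderedModule ℝ F] [HasSolidNorm F] [CompleteSpace F]
    (T : Complexification F →L[ℂ] Complexification F)
    (hr : spectralRadius ℂ T = 1)
    (hpos : Complexification.IsPositiveOp T)
    (hws : IsWSBounded.{w, u} T) :
    ∃ I : Submodule ℂ (Complexification F),
      IsClosed (I : Set (Complexification F)) ∧
      Complexification.IsLatticeIdeal I ∧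
      (∀ x ∈ I, T x ∈ I) ∧
      (∀ μ ∈ peripheralSpectrum T, ∀ z : Complexification F,
        Module.End.HasEigenvector (T : Module.End ℂ (Complexification F)) μ z →
          z ∉ I ∧
          T (Complexification.ofReal z.modulus) - Complexification.ofReal z.modulus ∈ I) ∧
      (∀ x : Complexification F,
        Tendsto (fun k : ℕ => (T ^ k) (Complexification.ofReal x.modulus)) atTop (𝓝 0) →
          x ∈ I) := by
  open Complexification in
  obtain ⟨J, _, _, _, f, hf, C, hC⟩ := hws
  have ha : ∀ j, IsBoundedWeight (realOp T) C fun k => (taylorCoeff (f j) k).re := fun j =>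
    hpos.isBoundedWeight_taylorCoeff hr.le (hf.analytic j) (hf.eval_one j) (hf.deriv_nonneg j)
      (hC j)
  choose b hb hle using fun n : ℕ =>
    IsBoundedWeight.exists_le (l := atTop) ha hf.tendsto_taylorCoeff n
  have hlim : Tendsto (fun n : ℕ => 2 / ((n : ℝ) + 2)) atTop (𝓝 0) :=
    tendsto_const_nhds.div_atTop (tendsto_atTop_add_const_right _ _ tendsto_natCast_atTop_atTop)
  have hS := hpos.realOp_nonneg
  refine ⟨nullIdeal hS hb, isClosed_nullIdeal hS hb, isLatticeIdeal_nullIdeal hS hb,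
    fun x hx => hpos.apply_mem_nullIdeal hb hx, fun μ hμ z hz => ?_, fun x hx => ?_⟩
  · have hμ1 : ‖μ‖ = 1 := by
      have h := hμ.2
      rw [hr] at h
      rw [← coe_nnnorm, ENNReal.coe_eq_one.1 h, NNReal.coe_one]
    -- Since `|μ| = 1`, `|z| = |μ z| = |T z| ≤ S |z|`.
    have hu : z.modulus ≤ realOp T z.modulus := by
      have h : T z = μ • z := hz.apply_eq_smul
      have h2 := hpos.modulus_apply_le z
      rwa [h, modulus_smul, hμ1, one_smul] at h2
    refine ⟨fun hzI => hz.2 (modulus_eq_zero ?_), ?_⟩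
    · exact le_antisymm (ge_of_tendsto' hzI fun m => (hb m).le_orbitAverage hS hu)
        (modulus_nonneg z)
    · rw [hpos.apply_ofReal, ← ofReal_sub, mem_nullIdeal, modulus_ofReal,
        abs_of_nonneg (sub_nonneg.2 hu)]
      exact IsBoundedWeight.tendsto_orbitAverage_sub hb hle hlim hS (modulus_nonneg z) hu
  · refine IsBoundedWeight.tendsto_orbitAverage_of_tendsto_pow hb hle hlim ?_
    rw [tendsto_zero_iff_norm_tendsto_zero] at hx ⊢
    exact hx.congr fun k => by rw [hpos.pow_apply_ofReal, norm_ofReal]
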